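/- Consider a fixed directed graph on followers $\mathcal F=\{1,\dots,n\}$ and leaders $\mathcal R=\{n+1,\dots,n+m\}$ with weights $a_{ij}\ge 0$, where $a_{ij}>0$ if and only if agent $i$ receives information from agent $j$ (an edge from $j$ to $i$), $a_{ii}=0$, and leaders receive no information. Assume that the graph is acyclic and that for each follower there is a leader with a directed path to it. Let the Laplacian be $\mathcal L=\begin{bmatrix}\mathcal L_1&\mathcal L_2\\0&0\end{bmatrix}$ with $\mathcal L_1\in\mathbb R^{n\times n}$, $\mathcal L_2\in\mathbb R^{n\times m}$, and let $\varphi_{ik}$ be the entry of $-\mathcal L_1^{-1}\mathcal L_2$ in the row of follower $i$ and the column of leader $k$. Let $\bar N_i^L\subseteq\mathcal R$ be the set of influential leaders of follower $i$, i.e. the leaders that are neighbours of $i$ or of a follower with a directed path to $i$, and let $\Phi^i_{P\ell}=[\varphi_{ik}]_{k\in\bar N_i^L}$ (a row vector). The leaders obey $$\dot\omega_k=S_k\omega_k,\qquad y_k=D_k\omega_k,\qquad S_k\in\mathbb R^{q\times q},\ D_k\in\mathbb R^{Q\times q},\qquad k\in\mathcal R,$$ and are marginally stable, i.e. every solution of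 $\dot x=S_kx$ is bounded on $[0,\infty)$. For $\beta^\eta,\beta^S,\beta^D>0$ let $\eta_i^k,S_i^k,D_i^k$ ($i\in\mathcal F$, $k\in\bar N_i^L$) be functions on $[0,\infty)$ satisfying the adaptive distributed observer $$\begin{aligned} \dot\eta_i^k&=S_i^k\eta_i^k+\beta^\eta\Big(\sum_{j\in\mathcal F,\,a_{ij}>0}a_{ij}(\eta_j^k-\eta_i^k)+a_{ik}(\omega_k-\eta_i^k)\Big),\\ \dot S_i^k&=\beta^S\Big(\sum_{j\in\mathcal F,\,a_{ij}>0}a_{ij}(S_j^k-S_i^k)+a_{ik}(S_k-S_i^k)\Big),\\ \dot D_i^k&=\beta^D\Big(\sum_{j\in\mathcal F,\,a_{ij}>0}a_{ij}(D_j^k-D_i^k)+a_{ik}(D_k-D_i^k)\Big), \end{aligned}$$ where in the equations of follower $i$ one reads $\eta_j^k:=\eta_i^k$, $S_j^k:=S_i^k$, $D_j^k:=D_i^k$ whenever $k\notin\bar N_j^L$. Put $\eta_i=\mathrm{col}(\eta_i^k)_{k\in\bar N_i^L}$, $\bar D_i=\mathrm{diag}(D_i^k)_{k\in\bar N_i^L}$,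 and let $$y_i^*=(\Phi^i_{P\ell}\otimes I_Q)\,\mathrm{diag}(D_k)_{k\in\bar N_i^L}\,\mathrm{col}(\omega_k)_{k\in\bar N_i^L}$$ be the virtual reference of follower $i$. Then for all $\beta^\eta,\beta^S,\beta^D>0$ and all initial conditions the estimated virtual reference $(\Phi^i_{P\ell}\otimes I_Q)\bar D_i\eta_i$ converges to $y_i^*$ exponentially for every $i\in\mathcal F$: there is $\alpha>0$, not depending on the initial conditions, such that for every solution and every $i\in\mathcal F$ there is a constant $C$ with $$\big\|(\Phi^i_{P\ell}\otimes I_Q)\bar D_i(t)\eta_i(t)-y_i^*(t)\big\|_2\le C e^{-\alpha t}\qquad\text{for all }t\ge 0.$$ -/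

import Mathlib

open Set Matrix
open scoped Kronecker

noncomputable section

/-- A fixed weighted directed communication graph on `n` followers `Sum.inl i` (the agents
`1, …, n`) and `m` leaders `Sum.inr k` (the agents `n + 1, …, n + m`). The weight `a v u` is
positive exactly when `(u, v)` is an edge, i.e. when agent `v` obtains information from
agent `u`. There are no self-connections, and leaders receive no information. -/
structure CommGraph (n m : ℕ) where
  /-- the weighted adjacency matrix -/
  a : Matrix (Fin n ⊕ Fin m) (Fin n ⊕ Fin m) ℝ
  nonneg : ∀ v u, 0 ≤ a v u
  hollow : ∀ v, a v v = 0
  leader_row : ∀ (k : Fin m) (u : Fin n ⊕ Fin m), a (Sum.inr k) u = 0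

namespace CommGraph

variable {n m : ℕ} (G : CommGraph n m)

/-- `(u, v)` is an edge of the graph. -/
def Edge (u v : Fin n ⊕ Fin m) : Prop := 0 < G.a v u

/-- There is a directed path (with at least one edge) from `u` to `v`: `u` influences `v`. -/
def Influences (u v : Fin n ⊕ Fin m) : Prop := Relation.TransGen G.Edge u v

/-- For each follower there is at least one leader that has a directed path to it. -/
def FollowersReachable : Prop :=
  ∀ i : Fin n, ∃ k : Fin m, G.Influences (Sum.inr k) (Sum.inl i)

/-- The directed graph has no directed cycle. -/
def Acyclic : Prop := ∀ v, ¬ G.Influences v v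

/-- The neighbours of a node. -/
def neighbors (v : Fin n ⊕ Fin m) : Finset (Fin n ⊕ Fin m) :=
  Finset.univ.filter fun u => 0 < G.a v u ∧ u ≠ v

/-- The Laplacian matrix. -/
def laplacian : Matrix (Fin n ⊕ Fin m) (Fin n ⊕ Fin m) ℝ :=
  Matrix.of fun v u => if v = u then ∑ w ∈ G.neighbors v, G.a v w else - G.a v u

/-- The follower-follower block of the Laplacian. -/
def L₁ : Matrix (Fin n) (Fin n) ℝ := G.laplacian.toBlocks₁₁

/-- The follower-leader block of the Laplacian. -/
def L₂ : Matrix (Fin n) (Fin m) ℝ := G.laplacian.toBlocks₁₂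

/-- The normalized levels of influence: row `i` contains those of all leaders on follower `i`. -/
def nli : Matrix (Fin n) (Fin m) ℝ := - G.L₁⁻¹ * G.L₂

/-- The leaders that are neighbours of follower `i`. -/
def neighborLeaders (i : Fin n) : Finset (Fin m) :=
  Finset.univ.filter fun k => G.a (Sum.inl i) (Sum.inr k) ≠ 0

/-- The followers that are neighbours of follower `i`. -/
def neighborFollowers (i : Fin n) : Finset (Fin n) :=
  Finset.univ.filter fun j => Sum.inl j ∈ G.neighbors (Sum.inl i)

open Classical in
/-- The influential followers of follower `i`, i.e. those with a directed path to `i`. -/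
def influentialFollowers (i : Fin n) : Finset (Fin n) :=
  Finset.univ.filter fun j => G.Influences (Sum.inl j) (Sum.inl i)

/-- The influential leaders of follower `i`: the leaders that are neighbours of `i` or of one of
its influential followers. -/
def influentialLeaders (i : Fin n) : Finset (Fin m) :=
  (G.influentialFollowers i ∪ {i}).biUnion G.neighborLeaders

/-- The row vector of the normalized levels of influence of the influential leaders of
follower `i` on it. Its columns are indexed by the influential leaders themselves. -/
def localNli (i : Fin n) : Matrix (Fin 1) (G.influentialLeaders i) ℝ :=
  Matrix.of fun _ k => G.nli i k

/-- A family of estimates: for every follower `i` and every influential leader `k` of `i`,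
the estimate `z i k` that follower `i` has of a quantity of leader `k`. -/
abbrev Estimates (X : Type) : Type := (i : Fin n) → G.influentialLeaders i → X

/-- The estimate for leader `k` that follower `i` uses for its neighbour `j`: the one of `j` if
`k` is an influential leader of `j`, and its own one otherwise. -/
def relayed {X : Type} (z : G.Estimates X) (i j : Fin n) (k : G.influentialLeaders i) : X :=
  if h : (k : Fin m) ∈ G.influentialLeaders j then z j ⟨k, h⟩ else z i k

/-- The coupling term `∑ⱼ aᵢⱼ (zⱼᵏ - zᵢᵏ) + aᵢₖ (rₖ - zᵢᵏ)` of the observers, with `j` ranging over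
the neighbouring followers of `i`, and `r k` the true quantity of leader `k`. -/
def coupling {X : Type} [AddCommGroup X] [Module ℝ X]
    (z : G.Estimates X) (r : Fin m → X) (i : Fin n) (k : G.influentialLeaders i) : X :=
  ∑ j ∈ G.neighborFollowers i, G.a (Sum.inl i) (Sum.inl j) • (G.relayed z i j k - z i k)
    + G.a (Sum.inl i) (Sum.inr k) • (r k - z i k)

end CommGraph

/-- `x' = S x` is marginally stable (stable in the sense of Lyapunov): every solution on
`[0, ∞)` is bounded. -/
def MarginallyStable {q : ℕ} (S : Matrix (Fin q) (Fin q) ℝ) : Prop :=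
  ∀ x : ℝ → Fin q → ℝ,
    (∀ t, 0 ≤ t → HasDerivWithinAt x (S *ᵥ x t) (Ici 0) t) →
      ∃ M : ℝ, ∀ t, 0 ≤ t → ‖x t‖ ≤ M

/-- The leaders' states solve `ωₖ' = Sₖ ωₖ` on `[0, ∞)`. -/
def IsLeaderTrajectory {m q : ℕ} (S : Fin m → Matrix (Fin q) (Fin q) ℝ)
    (ω : ℝ → Fin m → Fin q → ℝ) : Prop :=
  ∀ k t, 0 ≤ t → HasDerivWithinAt (fun τ => ω τ k) (S k *ᵥ ω t k) (Ici 0) t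

/-- The adaptive distributed observer on `[0, ∞)`: the state estimates `η` and the estimates
`Sh`, `Dh` of the leaders' matrices (whose derivatives are taken entrywise). -/
structure IsObserverTrajectory {n m q Q : ℕ} (G : CommGraph n m)
    (S : Fin m → Matrix (Fin q) (Fin q) ℝ) (D : Fin m → Matrix (Fin Q) (Fin q) ℝ)
    (βη βS βD : ℝ) (ω : ℝ → Fin m → Fin q → ℝ)
    (η : ℝ → G.Estimates (Fin q → ℝ))
    (Sh : ℝ → G.Estimates (Matrix (Fin q) (Fin q) ℝ))
    (Dh : ℝ → G.Estimates (Matrix (Fin Q) (Fin q) ℝ)) : Prop where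
  state : ∀ i k t, 0 ≤ t → HasDerivWithinAt (fun τ => η τ i k)
    (Sh t i k *ᵥ η t i k + βη • G.coupling (η t) (ω t) i k) (Ici 0) t
  dynamics : ∀ i k r c t, 0 ≤ t → HasDerivWithinAt (fun τ => Sh τ i k r c)
    ((βS • G.coupling (Sh t) S i k) r c) (Ici 0) t
  output : ∀ i k r c t, 0 ≤ t → HasDerivWithinAt (fun τ => Dh τ i k r c)
    ((βD • G.coupling (Dh t) D i k) r c) (Ici 0) t

/-- The block-diagonal matrix with the blocks `M k`, whose rows and columns are indexed by
pairs (block, position in the block), as for `⊗ₖ`. -/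
def blockDiagMatrix {ι : Type} [DecidableEq ι] {p q : ℕ} (M : ι → Matrix (Fin p) (Fin q) ℝ) :
    Matrix (ι × Fin p) (ι × Fin q) ℝ :=
  (Matrix.blockDiagonal M).submatrix Prod.swap Prod.swap

/-- The column stack of the vectors `x k`. -/
def colStack {ι : Type} {q : ℕ} (x : ι → Fin q → ℝ) : ι × Fin q → ℝ := fun p => x p.1 p.2

/-- The output `(Φ ⊗ I_Q) diag(Dₖ) col(xₖ) ∈ ℝ^Q`, with `k` ranging over the influential leaders
of follower `i` and `Φ` the row vector of their normalized levels of influence on `i`. -/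
def virtualOutput {n m q Q : ℕ} (G : CommGraph n m) (i : Fin n)
    (D : G.influentialLeaders i → Matrix (Fin Q) (Fin q) ℝ)
    (x : G.influentialLeaders i → Fin q → ℝ) : EuclideanSpace ℝ (Fin Q) :=
  WithLp.toLp 2 fun r =>
    ((G.localNli i ⊗ₖ (1 : Matrix (Fin Q) (Fin Q) ℝ)) *ᵥ (blockDiagMatrix D *ᵥ colStack x)) (0, r)

/-- The virtual reference `yᵢ*` of follower `i`, for the leaders' states `w`. -/
def virtualReference {n m q Q : ℕ} (G : CommGraph n m) (D : Fin m → Matrix (Fin Q) (Fin q) ℝ)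
    (w : Fin m → Fin q → ℝ) (i : Fin n) : EuclideanSpace ℝ (Fin Q) :=
  virtualOutput G i (fun k => D k) (fun k => w k)

/-- The estimate of the virtual reference by follower `i`. -/
def estimatedReference {n m q Q : ℕ} (G : CommGraph n m)
    (Dh : G.Estimates (Matrix (Fin Q) (Fin q) ℝ)) (η : G.Estimates (Fin q → ℝ)) (i : Fin n) :
    EuclideanSpace ℝ (Fin Q) :=
  virtualOutput G i (Dh i) (η i)

end

/-! The coupling terms depend only on the estimation errors. For each pair `(i, k)` they split into
a damping `-β w e`, with `w` the `correctionWeight`, and an input from the errors of neighbouring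
followers that also track leader `k`. Every such `w` is positive (`correctionWeight_pos`), so one `α
> 0` lies below all the products `β w`.

Acyclicity permits induction along edges: when follower `i` is reached, its inputs are already
`O(exp (-α t))`. Its error then solves `x' = (A - c) x` up to a perturbation at most `(b ‖x‖ + F)
exp (-α t)`, where `c = β w > α` and `A` generates a bounded semigroup: `A = S k` for states, `A =
0` for matrix entries. Variation of constants and Grönwall give decay at exactly the rate `α`
(`isBigO_exp_of_perturbed_linear`), so no rate is lost along the graph. The levels of influence
enter only as fixed coefficients of the output. -/

open Filter Asymptotics NormedSpace Topology

/-! ### Exponentially perturbed linear differential equations -/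

section LinearODE

variable {E : Type*} [NormedAddCommGroup E] [NormedSpace ℝ E] [CompleteSpace E]

/-- Variation of constants, in the form of an estimate. -/
theorem norm_le_of_perturbed_linear {A : E →L[ℝ] E} {M c : ℝ}
    (hM : ∀ t : ℝ, 0 ≤ t → ‖exp (t • A)‖ ≤ M) {x x' : ℝ → E} {φ W : ℝ → ℝ}
    (hx : ∀ t, 0 ≤ t → HasDerivWithinAt x (x' t) (Ici 0) t)
    (hφ : ∀ t, 0 ≤ t → M * (Real.exp (c * t) * ‖x' t - (A (x t) - c • x t)‖) ≤ φ t)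
    (hW : ∀ t, HasDerivAt W (φ t) t) (hW0 : M * ‖x 0‖ ≤ W 0) {T : ℝ} (hT : 0 ≤ T) :
    Real.exp (c * T) * ‖x T‖ ≤ W T := by
  -- This conjugation cancels the linear part, leaving only the residual in `y'`; at `s = T` it is
  -- `exp (c T) x(T)`.
  let y : ℝ → E := fun s => exp ((T - s) • A) (Real.exp (c * s) • x s)
  have hy : ∀ s, 0 ≤ s → HasDerivWithinAt y
      (exp ((T - s) • A) (Real.exp (c * s) • (x' s - (A (x s) - c • x s)))) (Ici 0) s := by
    intro s hs
    have h1 : HasDerivAt (fun s : ℝ => exp ((T - s) • A))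
        ((-1 : ℝ) • (exp ((T - s) • A) * A)) s :=
      (hasDerivAt_exp_smul_const (𝕂 := ℝ) A (T - s)).scomp s
        ((hasDerivAt_id s).const_sub T)
    have h2 : HasDerivAt (fun s : ℝ => Real.exp (c * s)) (Real.exp (c * s) * c) s := by
      simpa using ((hasDerivAt_id s).const_mul c).exp
    have h3 := h1.hasDerivWithinAt (s := Ici 0) |>.clm_apply
      (h2.hasDerivWithinAt (s := Ici 0) |>.smul (hx s hs))
    refine h3.congr_deriv ?_
    have e : ((-1 : ℝ) • (exp ((T - s) • A) * A)) (Real.exp (c * s) • x s)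
        = -(Real.exp (c * s) • exp ((T - s) • A) (A (x s))) := by
      rw [map_smul, neg_one_smul, ← smul_neg]
      rfl
    refine (congrArg (· + _) e).trans ?_
    simp only [map_add, map_smul, map_sub]
    module
  have hcont : ContinuousOn y (Icc 0 T) := fun s hs =>
    ((hy s hs.1).continuousWithinAt).mono Icc_subset_Ici_self
  have key := image_norm_le_of_norm_deriv_right_le_deriv_boundary (f := y) (B := W) (B' := φ)
    (a := 0) (b := T) hcont
    (fun s hs => (hy s hs.1).mono (Ici_subset_Ici.2 hs.1))
    (by
      have := (exp ((T - 0) • A)).le_opNorm (Real.exp (c * 0) • x 0)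
      refine this.trans (le_trans ?_ hW0)
      simp only [mul_zero, Real.exp_zero, one_smul]
      exact mul_le_mul_of_nonneg_right (hM _ (by linarith)) (norm_nonneg _))
    (fun s => hW s)
    (fun s hs => by
      refine le_trans (ContinuousLinearMap.le_opNorm _ _) (le_trans ?_ (hφ s hs.1))
      rw [norm_smul, Real.norm_eq_abs, Real.abs_exp]
      exact mul_le_mul_of_nonneg_right (hM _ (by linarith [hs.2])) (by positivity))
    (right_mem_Icc.2 hT)
  simpa [y, norm_smul] using key

/-- Grönwall's inequality for an exponentially decaying coefficient. -/
theorem gronwall_exp_decay {W W' : ℝ → ℝ} {α γ b F : ℝ} (hα : 0 < α) (hγ : 0 < γ)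
    (hb : 0 ≤ b) (hF : 0 ≤ F) (hW : ∀ t, HasDerivAt W (W' t) t) (hW0 : ∀ t, 0 ≤ t → 0 ≤ W t)
    (hW' : ∀ t, 0 ≤ t → W' t ≤ b * Real.exp (-α * t) * W t + F * Real.exp (γ * t)) :
    ∃ C, ∀ t, 0 ≤ t → W t ≤ C * Real.exp (γ * t) := by
  set k := b / α with hk
  have hk0 : 0 ≤ k := by positivity
  have hkα : k * α = b := by rw [hk]; field_simp
  set K := Real.exp k * F / γ with hK
  have hK0 : 0 ≤ K := by positivity
  have hKγ : K * γ = Real.exp k * F := by rw [hK]; field_simp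
  -- Integrating factor: `μ' = -b exp (-α t) μ`, and `1 ≤ μ ≤ exp k` for `t ≥ 0`. The constant `K`
  -- makes the derivative of `Z` nonpositive.
  let μ : ℝ → ℝ := fun t => Real.exp (k * Real.exp (-α * t))
  have hμ : ∀ t, HasDerivAt μ (μ t * (k * (Real.exp (-α * t) * -α))) t := fun t => by
    have h := ((((hasDerivAt_id t).const_mul (-α)).exp).const_mul k).exp
    simp only [id, mul_one] at h
    exact h
  let Z : ℝ → ℝ := fun t => W t * μ t - K * Real.exp (γ * t)
  have hZ : ∀ t, HasDerivAt Z (W' t * μ t + W t * (μ t * (k * (Real.exp (-α * t) * -α)))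
      - K * (Real.exp (γ * t) * γ)) t := fun t => by
    have h := ((((hasDerivAt_id t).const_mul γ).exp).const_mul K)
    simp only [id, mul_one] at h
    exact ((hW t).mul (hμ t)).sub h
  have hanti : AntitoneOn Z (Ici 0) := by
    refine antitoneOn_of_deriv_nonpos (convex_Ici 0)
      (fun t _ => (hZ t).continuousAt.continuousWithinAt)
      (fun t _ => (hZ t).differentiableAt.differentiableWithinAt) ?_
    intro t ht
    rw [interior_Ici] at ht
    have ht : 0 < t := ht
    rw [(hZ t).deriv]
    have h1 := mul_le_mul_of_nonneg_right (hW' t ht.le) (Real.exp_pos (k * Real.exp (-α * t))).le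
    have h2 : μ t ≤ Real.exp k := Real.exp_le_exp.2 (mul_le_of_le_one_right hk0
      (Real.exp_le_one_iff.2 (by nlinarith)))
    have h3 := mul_le_mul_of_nonneg_left h2 (mul_nonneg hF (Real.exp_pos (γ * t)).le)
    change W' t * μ t ≤ _ * μ t at h1
    have e1 : W t * (μ t * (k * (Real.exp (-α * t) * -α)))
        = -(b * Real.exp (-α * t) * W t * μ t) := by rw [← hkα]; ring
    have e2 : K * (Real.exp (γ * t) * γ) = F * Real.exp (γ * t) * Real.exp k := by
      linear_combination Real.exp (γ * t) * hKγ
    rw [e1, e2]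
    linarith
  refine ⟨|Z 0| + K, fun t ht => ?_⟩
  have h1 : Z t ≤ Z 0 := hanti (mem_Ici.2 le_rfl) ht ht
  have h2 : W t ≤ W t * μ t :=
    le_mul_of_one_le_right (hW0 t ht) (Real.one_le_exp (by positivity))
  have h3 : 1 ≤ Real.exp (γ * t) := Real.one_le_exp (by positivity)
  have h4 := mul_le_mul_of_nonneg_left h3 (abs_nonneg (Z 0))
  have h5 := le_abs_self (Z 0)
  simp only [Z] at h1
  simp only [Z] at h4 h5 ⊢
  linarith

/-- A solution of `x' = (A - c) x + B(t) x + f(t)`, where the semigroup of `A` is bounded and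
`B`, `f` decay exponentially at a rate `α < c`, decays exponentially at the rate `α`. -/
theorem isBigO_exp_of_perturbed_linear {A : E →L[ℝ] E} {M c α b F : ℝ}
    (hM : ∀ t : ℝ, 0 ≤ t → ‖exp (t • A)‖ ≤ M) (hα : 0 < α) (hαc : α < c) (hb : 0 ≤ b) (hF : 0 ≤ F)
    {x x' : ℝ → E} (hx : ∀ t, 0 ≤ t → HasDerivWithinAt x (x' t) (Ici 0) t)
    (hx' : ∀ t, 0 ≤ t →
      ‖x' t - (A (x t) - c • x t)‖ ≤ (b * ‖x t‖ + F) * Real.exp (-α * t)) :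
    x =O[𝓟 (Ici 0)] fun t => Real.exp (-α * t) := by
  have hM0 : 0 ≤ M := (norm_nonneg _).trans (hM 0 le_rfl)
  -- Freezing `x` at `x 0` for negative times makes `φ` continuous on all of `ℝ`, so its primitive
  -- `W` is differentiable everywhere.
  let φ : ℝ → ℝ := fun t =>
    M * (Real.exp (c * t) * ((b * ‖x (max t 0)‖ + F) * Real.exp (-α * t)))
  have hφ0 : ∀ t, 0 ≤ φ t := fun t => by positivity
  have hxc : Continuous fun t : ℝ => x (max t 0) := by
    have h : ContinuousOn x (Ici 0) := fun t ht => (hx t ht).continuousWithinAt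
    exact h.comp_continuous (by fun_prop) fun t => mem_Ici.2 (le_max_right t 0)
  have hφc : Continuous φ := by
    have h := hxc.norm
    simp only [φ]
    exact continuous_const.mul ((by fun_prop : Continuous fun t => Real.exp (c * t)).mul
      (((continuous_const.mul h).add continuous_const).mul (by fun_prop)))
  let W : ℝ → ℝ := fun t => M * ‖x 0‖ + ∫ s in (0 : ℝ)..t, φ s
  have hW : ∀ t, HasDerivAt W (φ t) t := fun t =>
    (hφc.integral_hasStrictDerivAt 0 t).hasDerivAt.const_add _
  have hxW : ∀ t, 0 ≤ t → Real.exp (c * t) * ‖x t‖ ≤ W t := fun t ht =>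
    norm_le_of_perturbed_linear hM hx
      (fun s hs => by
        have := hx' s hs
        simp only [φ, max_eq_left hs]
        gcongr) hW (by simp [W]) ht
  -- Growth of `W` at rate `c - α` becomes decay of `x` at rate `α` after division by `exp (c t)`.
  obtain ⟨C, hC⟩ := gronwall_exp_decay (W := W) (W' := φ) (α := α) (γ := c - α) (b := M * b)
    (F := M * F) hα (sub_pos.2 hαc) (by positivity) (by positivity) hW
    (fun t ht => le_trans (by positivity) (hxW t ht))
    (fun t ht => by
      have h := mul_le_mul_of_nonneg_left (hxW t ht)
        (show 0 ≤ M * b * Real.exp (-α * t) by positivity)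
      have e : Real.exp ((c - α) * t) = Real.exp (c * t) * Real.exp (-α * t) := by
        rw [← Real.exp_add]; ring_nf
      simp only [φ, max_eq_left ht]
      rw [e]
      linarith)
  refine isBigO_principal.2 ⟨C, fun t ht => ?_⟩
  have h := (hxW t ht).trans (hC t ht)
  have e : Real.exp ((c - α) * t) = Real.exp (c * t) * Real.exp (-α * t) := by
    rw [← Real.exp_add]; ring_nf
  rw [Real.norm_eq_abs, Real.abs_exp]
  refine le_of_mul_le_mul_left (h.trans_eq ?_) (Real.exp_pos (c * t))
  rw [e]; ring

end LinearODE

/-- The semigroup of a marginally stable matrix is bounded. -/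
theorem MarginallyStable.exists_norm_exp_le {q : ℕ} {S : Matrix (Fin q) (Fin q) ℝ}
    (hS : MarginallyStable S) :
    ∃ M : ℝ, ∀ t : ℝ, 0 ≤ t → ‖exp (t • LinearMap.toContinuousLinearMap S.mulVecLin)‖ ≤ M := by
  set A := LinearMap.toContinuousLinearMap S.mulVecLin with hA
  -- Stability bounds each orbit separately; uniform boundedness turns this into a bound on the
  -- operators.
  have h := banach_steinhaus (ι := Ici (0 : ℝ)) (g := fun t => exp ((t : ℝ) • A)) fun v => by
    obtain ⟨M, hM⟩ := hS (fun t => exp (t • A) v) fun t _ => by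
      have h1 := (hasDerivAt_exp_smul_const' (𝕂 := ℝ) A t).clm_apply (hasDerivAt_const t v)
      refine (h1.congr_deriv ?_).hasDerivWithinAt
      simp [hA]
    exact ⟨M, fun t => hM t t.2⟩
  obtain ⟨M, hM⟩ := h
  exact ⟨M, fun t ht => hM ⟨t, mem_Ici.2 ht⟩⟩

/-! ### Error coupling on the graph and induction along edges -/

namespace CommGraph

variable {n m : ℕ} (G : CommGraph n m)

/-- Used to reduce matrix estimates to scalar equations, one per entry. -/
theorem map_coupling {X Y : Type} [AddCommGroup X] [Module ℝ X] [AddCommGroup Y] [Module ℝ Y]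
    (f : X →ₗ[ℝ] Y) (z : G.Estimates X) (r : Fin m → X) (i : Fin n)
    (k : G.influentialLeaders i) :
    f (G.coupling z r i k) = G.coupling (fun i k => f (z i k)) (fun k => f (r k)) i k := by
  simp only [coupling, relayed, map_add, map_sum, map_smul, map_sub]
  congr 1
  refine Finset.sum_congr rfl fun j _ => ?_
  split_ifs <;> rfl

variable {X : Type} [AddCommGroup X] [Module ℝ X]

theorem coupling_eq_coupling_error (z : G.Estimates X) (r : Fin m → X) (i : Fin n)
    (k : G.influentialLeaders i) :
    G.coupling z r i k = G.coupling (fun i k => z i k - r k) (fun _ => 0) i k := by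
  simp only [coupling, relayed]
  congr 1
  · refine Finset.sum_congr rfl fun j _ => ?_
    split_ifs <;> simp
  · simp

/-- The total weight with which follower `i` corrects its estimate for leader `k`. -/
noncomputable def correctionWeight (i : Fin n) (k : Fin m) : ℝ :=
  (∑ j ∈ G.neighborFollowers i,
    if k ∈ G.influentialLeaders j then G.a (Sum.inl i) (Sum.inl j) else 0)
    + G.a (Sum.inl i) (Sum.inr k)

/-- The contribution of the neighbouring followers to the coupling term. -/
noncomputable def followerInput (e : G.Estimates X) (i : Fin n) (k : G.influentialLeaders i) : X :=
  ∑ j ∈ G.neighborFollowers i, G.a (Sum.inl i) (Sum.inl j) •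
    if h : (k : Fin m) ∈ G.influentialLeaders j then e j ⟨k, h⟩ else 0

/-- A neighbour not influenced by `k` relays the follower's own estimate, so it contributes neither
input nor damping. -/
theorem coupling_zero (e : G.Estimates X) (i : Fin n) (k : G.influentialLeaders i) :
    G.coupling e (fun _ => 0) i k = G.followerInput e i k - G.correctionWeight i k • e i k := by
  simp only [coupling, relayed, followerInput, correctionWeight, add_smul, Finset.sum_smul,
    zero_sub, smul_neg, ← sub_eq_add_neg, ← sub_sub, ← Finset.sum_sub_distrib]
  congr 1
  refine Finset.sum_congr rfl fun j _ => ?_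
  split_ifs <;> simp [smul_sub]

theorem mem_neighborFollowers {i j : Fin n} :
    j ∈ G.neighborFollowers i ↔ G.Edge (Sum.inl j) (Sum.inl i) := by
  simp only [neighborFollowers, neighbors, Edge, Finset.mem_filter, Finset.mem_univ, true_and]
  refine ⟨fun h => h.1, fun h => ⟨h, fun e => ?_⟩⟩
  rw [e, G.hollow] at h
  exact lt_irrefl _ h

theorem mem_influentialLeaders {i : Fin n} {k : Fin m} :
    k ∈ G.influentialLeaders i ↔ ∃ j : Fin n,
      (j = i ∨ G.Influences (Sum.inl j) (Sum.inl i)) ∧ G.a (Sum.inl j) (Sum.inr k) ≠ 0 := by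
  simp [influentialLeaders, influentialFollowers, neighborLeaders]

theorem correctionWeight_pos {i : Fin n} {k : Fin m} (hk : k ∈ G.influentialLeaders i) :
    0 < G.correctionWeight i k := by
  have hterm : ∀ j ∈ G.neighborFollowers i,
      0 ≤ if k ∈ G.influentialLeaders j then G.a (Sum.inl i) (Sum.inl j) else 0 := fun j _ => by
    split_ifs
    exacts [G.nonneg _ _, le_rfl]
  obtain ⟨j, hj, hjk⟩ := G.mem_influentialLeaders.1 hk
  have hdirect : G.a (Sum.inl i) (Sum.inr k) ≠ 0 → 0 < G.correctionWeight i k := fun h =>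
    add_pos_of_nonneg_of_pos (Finset.sum_nonneg hterm) (lt_of_le_of_ne (G.nonneg _ _) h.symm)
  have hvia : ∀ l : Fin n, G.Edge (Sum.inl l) (Sum.inl i) → k ∈ G.influentialLeaders l →
      0 < G.correctionWeight i k := fun l hl hkl =>
    add_pos_of_pos_of_nonneg
      (Finset.sum_pos' hterm ⟨l, G.mem_neighborFollowers.2 hl, by rw [if_pos hkl]; exact hl⟩)
      (G.nonneg _ _)
  rcases hj with rfl | hj
  · exact hdirect hjk
  -- The last edge of the path from `j` to `i` starts at a follower, as leaders have no incoming
  -- edges. The rest of the path shows that `k` influences this follower too.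
  · rcases Relation.TransGen.tail'_iff.1 hj with ⟨v, hv, hvi⟩
    rcases v with l | l
    · refine hvia l hvi (G.mem_influentialLeaders.2 ⟨j, ?_, hjk⟩)
      rcases Relation.reflTransGen_iff_eq_or_transGen.1 hv with h | h
      · exact Or.inl (Sum.inl.inj h).symm
      · exact Or.inr h
    · rcases Relation.reflTransGen_iff_eq_or_transGen.1 hv with h | h
      · cases h
      · obtain ⟨u, -, hu⟩ := Relation.TransGen.tail'_iff.1 h
        simp [Edge, G.leader_row] at hu

/-- Finitely many positive bounds leave room for all small `α > 0`. -/
theorem exists_rate_lt {β : ℝ} (hβ : 0 < β) :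
    ∃ α : ℝ, 0 < α ∧ ∀ i, ∀ k ∈ G.influentialLeaders i, α < β * G.correctionWeight i k := by
  have h : ∀ᶠ α in 𝓝[>] (0 : ℝ), ∀ i, ∀ k ∈ G.influentialLeaders i,
      α < β * G.correctionWeight i k := by
    refine eventually_all.2 fun i => (eventually_all_finset _).2 fun k hk => ?_
    exact (eventually_lt_nhds (mul_pos hβ (G.correctionWeight_pos hk))).filter_mono
      nhdsWithin_le_nhds
  obtain ⟨α, h1, h2⟩ := (h.and self_mem_nhdsWithin).exists
  exact ⟨α, h2, h1⟩

variable {G} in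
theorem Acyclic.wellFounded (hG : G.Acyclic) :
    WellFounded fun i j : Fin n => G.Edge (Sum.inl i) (Sum.inl j) := by
  have : IsTrans _ G.Influences := ⟨fun _ _ _ => Relation.TransGen.trans⟩
  have : Std.Irrefl G.Influences := ⟨hG⟩
  have h : WellFounded G.Influences := Finite.wellFounded_of_trans_of_irrefl _
  exact Subrelation.wf (fun h => Relation.TransGen.single h) (InvImage.wf Sum.inl h)

variable {G} in
/-- On an acyclic graph, the estimation errors of an observer with exponentially vanishing
perturbations decay exponentially. -/
theorem Acyclic.isBigO_error (hG : G.Acyclic) {E : Type} [NormedAddCommGroup E] [NormedSpace ℝ E]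
    [CompleteSpace E] {A : Fin m → E →L[ℝ] E}
    (hA : ∀ k, ∃ M : ℝ, ∀ t : ℝ, 0 ≤ t → ‖exp (t • A k)‖ ≤ M) {α β : ℝ} (hα : 0 < α)
    (hαβ : ∀ i, ∀ k ∈ G.influentialLeaders i, α < β * G.correctionWeight i k)
    {e e' : ℝ → G.Estimates E}
    (he : ∀ i k t, 0 ≤ t → HasDerivWithinAt (fun τ => e τ i k) (e' t i k) (Ici 0) t)
    (he' : ∀ i (k : G.influentialLeaders i), ∃ b F : ℝ, 0 ≤ b ∧ 0 ≤ F ∧ ∀ t, 0 ≤ t →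
      ‖e' t i k - (A k (e t i k) + β • G.coupling (e t) (fun _ => 0) i k)‖
        ≤ (b * ‖e t i k‖ + F) * Real.exp (-α * t)) (i : Fin n) (k : G.influentialLeaders i) :
    (fun t => e t i k) =O[𝓟 (Ici 0)] fun t => Real.exp (-α * t) := by
  induction i using hG.wellFounded.induction with
  | _ i ih =>
  have hin : (fun t => G.followerInput (e t) i k) =O[𝓟 (Ici 0)] fun t => Real.exp (-α * t) := by
    unfold followerInput
    refine IsBigO.fun_sum fun j hj => IsBigO.const_smul_left ?_ _
    split_ifs with h
    · exact ih j (G.mem_neighborFollowers.1 hj) ⟨k, h⟩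
    · exact isBigO_zero _ _
  obtain ⟨C, hC⟩ := isBigO_principal.1 (hin.const_smul_left β)
  obtain ⟨b, F, hb, hF, hbF⟩ := he' i k
  obtain ⟨M, hM⟩ := hA k
  refine isBigO_exp_of_perturbed_linear hM hα (hαβ i k k.2) hb
    (add_nonneg hF (abs_nonneg C)) (he i k) fun t ht => ?_
  have h1 := hbF t ht
  have h2 : ‖β • G.followerInput (e t) i k‖ ≤ |C| * Real.exp (-α * t) := by
    have := hC t ht
    rw [Real.norm_eq_abs, Real.abs_exp] at this
    exact this.trans (mul_le_mul_of_nonneg_right (le_abs_self C) (Real.exp_pos _).le)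
  -- The damping joins the linear part; the neighbours' input, already known to decay, joins the
  -- perturbation.
  have h3 : e' t i k - (A k (e t i k) - (β * G.correctionWeight i k) • e t i k)
      = (e' t i k - (A k (e t i k) + β • G.coupling (e t) (fun _ => 0) i k))
        + β • G.followerInput (e t) i k := by
    rw [coupling_zero]; module
  rw [h3]
  refine (norm_add_le _ _).trans ((add_le_add h1 h2).trans_eq ?_)
  ring

end CommGraph

/-! ### Entrywise bounds for matrix-vector products -/

theorem norm_mulVec_le_sum {p q : ℕ} (M : Matrix (Fin p) (Fin q) ℝ) (x : Fin q → ℝ) :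
    ‖M *ᵥ x‖ ≤ (∑ r, ∑ c, ‖M r c‖) * ‖x‖ := by
  refine (pi_norm_le_iff_of_nonneg (by positivity)).2 fun r => ?_
  calc ‖(M *ᵥ x) r‖ ≤ ∑ c, ‖M r c * x c‖ :=
        norm_sum_le Finset.univ fun c => M r c * x c
    _ ≤ ∑ c, ‖M r c‖ * ‖x‖ := Finset.sum_le_sum fun c _ => by
        rw [norm_mul]
        exact mul_le_mul_of_nonneg_left (norm_le_pi_norm x c) (norm_nonneg _)
    _ = (∑ c, ‖M r c‖) * ‖x‖ := (Finset.sum_mul _ _ _).symm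
    _ ≤ _ := mul_le_mul_of_nonneg_right
        (Finset.single_le_sum (f := fun r => ∑ c, ‖M r c‖) (fun _ _ => by positivity)
          (Finset.mem_univ r)) (norm_nonneg _)

theorem isBigO_mulVec {p q : ℕ} {l : Filter ℝ} {M : ℝ → Matrix (Fin p) (Fin q) ℝ}
    {x : ℝ → Fin q → ℝ} {f g : ℝ → ℝ} (hM : ∀ r c, (fun t => M t r c) =O[l] f)
    (hx : x =O[l] g) : (fun t => M t *ᵥ x t) =O[l] fun t => f t * g t := by
  have h : (fun t => ∑ r, ∑ c, ‖M t r c‖) =O[l] f :=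
    IsBigO.fun_sum fun r _ => IsBigO.fun_sum fun c _ => (hM r c).norm_left
  refine IsBigO.trans (IsBigO.of_norm_le fun t => ?_) (h.mul hx.norm_left)
  exact norm_mulVec_le_sum _ _

/-! ### Convergence of the adaptive observer -/

section Observer

variable {n m q Q : ℕ} {G : CommGraph n m}

/-- Adaptive estimates of the entries of the leaders' matrices converge exponentially. -/
theorem isBigO_matrix_error (hG : G.Acyclic) {p : ℕ} {α β : ℝ} (hα : 0 < α)
    (hαβ : ∀ i, ∀ k ∈ G.influentialLeaders i, α < β * G.correctionWeight i k)
    {R : Fin m → Matrix (Fin p) (Fin q) ℝ} {Z : ℝ → G.Estimates (Matrix (Fin p) (Fin q) ℝ)}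
    (hZ : ∀ i k r c t, 0 ≤ t → HasDerivWithinAt (fun τ => Z τ i k r c)
      ((β • G.coupling (Z t) R i k) r c) (Ici 0) t)
    (i : Fin n) (k : G.influentialLeaders i) (r : Fin p) (c : Fin q) :
    (fun t => (Z t i k - R k) r c) =O[𝓟 (Ici 0)] fun t => Real.exp (-α * t) := by
  refine hG.isBigO_error (A := fun _ => (0 : ℝ →L[ℝ] ℝ)) (e := fun t i k => (Z t i k - R k) r c)
    (e' := fun t i k => (β • G.coupling (Z t) R i k) r c)
    (fun _ => ⟨‖(1 : ℝ →L[ℝ] ℝ)‖, fun t _ => by simp⟩) hα hαβ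
    (fun i k t ht => (hZ i k r c t ht).sub_const _)
    (fun i k => ⟨0, 0, le_rfl, le_rfl, fun t _ => ?_⟩) i k
  have h := G.map_coupling (Matrix.entryLinearMap ℝ ℝ r c) (fun i k => Z t i k - R k)
    (fun _ => 0) i k
  rw [← G.coupling_eq_coupling_error] at h
  have h' : (G.coupling (Z t) R i k) r c
      = G.coupling (fun i k => (Z t i k - R k) r c) (fun _ => 0) i k := h
  simp [Matrix.smul_apply, h']

theorem IsLeaderTrajectory.isBigO_one {S : Fin m → Matrix (Fin q) (Fin q) ℝ}
    (hS : ∀ k, MarginallyStable (S k)) {ω : ℝ → Fin m → Fin q → ℝ}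
    (hω : IsLeaderTrajectory S ω) (k : Fin m) :
    (fun t => ω t k) =O[𝓟 (Ici 0)] fun _ => (1 : ℝ) := by
  obtain ⟨M, hM⟩ := hS k (fun t => ω t k) (hω k)
  exact isBigO_principal.2 ⟨M, fun t ht => by simpa using hM t ht⟩

variable {S : Fin m → Matrix (Fin q) (Fin q) ℝ} {D : Fin m → Matrix (Fin Q) (Fin q) ℝ}
  {βη βS βD α : ℝ} {ω : ℝ → Fin m → Fin q → ℝ} {η : ℝ → G.Estimates (Fin q → ℝ)}
  {Sh : ℝ → G.Estimates (Matrix (Fin q) (Fin q) ℝ)}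
  {Dh : ℝ → G.Estimates (Matrix (Fin Q) (Fin q) ℝ)}

theorem IsObserverTrajectory.isBigO_state_error
    (h : IsObserverTrajectory G S D βη βS βD ω η Sh Dh) (hG : G.Acyclic)
    (hS : ∀ k, MarginallyStable (S k)) (hω : IsLeaderTrajectory S ω) (hα : 0 < α)
    (hη : ∀ i, ∀ k ∈ G.influentialLeaders i, α < βη * G.correctionWeight i k)
    (hβS : ∀ i, ∀ k ∈ G.influentialLeaders i, α < βS * G.correctionWeight i k)
    (i : Fin n) (k : G.influentialLeaders i) :
    (fun t => η t i k - ω t k) =O[𝓟 (Ici 0)] fun t => Real.exp (-α * t) := by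
  refine hG.isBigO_error (A := fun k => LinearMap.toContinuousLinearMap (S k).mulVecLin)
    (e := fun t i k => η t i k - ω t k)
    (e' := fun t i k => (Sh t i k *ᵥ η t i k + βη • G.coupling (η t) (ω t) i k) - S k *ᵥ ω t k)
    (fun k => (hS k).exists_norm_exp_le) hα hη
    (fun i k t ht => (h.state i k t ht).sub (hω k t ht)) (fun i k => ?_) i k
  have hM := isBigO_matrix_error hG hα hβS h.dynamics i k
  obtain ⟨b, hb⟩ := isBigO_principal.1
    (IsBigO.fun_sum fun r (_ : r ∈ Finset.univ) =>
      IsBigO.fun_sum fun c (_ : c ∈ Finset.univ) => (hM r c).norm_left)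
  obtain ⟨F, hF⟩ := isBigO_principal.1 (isBigO_mulVec hM (hω.isBigO_one hS k))
  refine ⟨|b|, |F|, abs_nonneg _, abs_nonneg _, fun t ht => ?_⟩
  -- Writing `η = e + ω` splits the matrix error's effect into a decaying coefficient on `e` and a
  -- decaying forcing, since `ω` is bounded.
  have e1 : (Sh t i k *ᵥ η t i k + βη • G.coupling (η t) (ω t) i k) - S k *ᵥ ω t k
      - (LinearMap.toContinuousLinearMap (S k).mulVecLin (η t i k - ω t k)
        + βη • G.coupling (fun i k => η t i k - ω t k) (fun _ => 0) i k)
      = (Sh t i k - S k) *ᵥ (η t i k - ω t k) + (Sh t i k - S k) *ᵥ ω t k := by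
    rw [← G.coupling_eq_coupling_error]
    simp only [LinearMap.coe_toContinuousLinearMap', Matrix.mulVecLin_apply, Matrix.mulVec_sub,
      Matrix.sub_mulVec]
    abel
  have h1 : ‖(Sh t i k - S k) *ᵥ (η t i k - ω t k)‖
      ≤ |b| * Real.exp (-α * t) * ‖η t i k - ω t k‖ := by
    refine (norm_mulVec_le_sum _ _).trans (mul_le_mul_of_nonneg_right ?_ (norm_nonneg _))
    have := (le_abs_self _).trans (hb t ht)
    rw [Real.norm_eq_abs, Real.abs_exp] at this
    exact this.trans (mul_le_mul_of_nonneg_right (le_abs_self b) (Real.exp_pos _).le)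
  have h2 : ‖(Sh t i k - S k) *ᵥ ω t k‖ ≤ |F| * Real.exp (-α * t) := by
    have := hF t ht
    rw [mul_one, Real.norm_eq_abs, Real.abs_exp] at this
    exact this.trans (mul_le_mul_of_nonneg_right (le_abs_self F) (Real.exp_pos _).le)
  rw [e1]
  refine (norm_add_le _ _).trans ((add_le_add h1 h2).trans_eq ?_)
  ring

/-- The error is `(Dh - D) η + D (η - ω)`: decaying times bounded, plus constant times decaying. -/
theorem IsObserverTrajectory.isBigO_output_error
    (h : IsObserverTrajectory G S D βη βS βD ω η Sh Dh) (hG : G.Acyclic)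
    (hS : ∀ k, MarginallyStable (S k)) (hω : IsLeaderTrajectory S ω) (hα : 0 < α)
    (hη : ∀ i, ∀ k ∈ G.influentialLeaders i, α < βη * G.correctionWeight i k)
    (hβS : ∀ i, ∀ k ∈ G.influentialLeaders i, α < βS * G.correctionWeight i k)
    (hβD : ∀ i, ∀ k ∈ G.influentialLeaders i, α < βD * G.correctionWeight i k)
    (i : Fin n) (k : G.influentialLeaders i) :
    (fun t => Dh t i k *ᵥ η t i k - D k *ᵥ ω t k) =O[𝓟 (Ici 0)]
      fun t => Real.exp (-α * t) := by
  have hM := isBigO_matrix_error hG hα hβD h.output i k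
  have he := h.isBigO_state_error hG hS hω hα hη hβS i k
  have hexp : (fun t => Real.exp (-α * t)) =O[𝓟 (Ici 0)] fun _ => (1 : ℝ) :=
    isBigO_principal.2 ⟨1, fun t ht => by
      have ht : 0 ≤ t := ht
      rw [Real.norm_eq_abs, Real.abs_exp, norm_one, one_mul, Real.exp_le_one_iff]
      nlinarith⟩
  have hη1 : (fun t => η t i k) =O[𝓟 (Ici 0)] fun _ => (1 : ℝ) := by
    simpa using (he.trans hexp).add (hω.isBigO_one hS k)
  have h1 := isBigO_mulVec hM hη1
  have h2 := isBigO_mulVec (M := fun _ => D k) (f := fun _ => 1)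
    (fun r c => isBigO_const_const _ one_ne_zero _) he
  simp only [mul_one] at h1
  simp only [one_mul] at h2
  refine (h1.add h2).congr_left fun t => ?_
  simp only [Matrix.mulVec_sub, Matrix.sub_mulVec]
  abel

theorem virtualOutput_apply (i : Fin n) (M : G.influentialLeaders i → Matrix (Fin Q) (Fin q) ℝ)
    (x : G.influentialLeaders i → Fin q → ℝ) (r : Fin Q) :
    virtualOutput G i M x r = ∑ k, G.localNli i 0 k * (M k *ᵥ x k) r := by
  have hblock : ∀ k s, (blockDiagMatrix M *ᵥ colStack x) (k, s) = (M k *ᵥ x k) s := by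
    intro k s
    simp only [Matrix.mulVec, dotProduct, Fintype.sum_prod_type, blockDiagMatrix, colStack,
      Matrix.submatrix_apply, Matrix.blockDiagonal_apply, Prod.swap]
    rw [Finset.sum_eq_single k (fun l _ hl => by simp [hl.symm]) (by simp)]
    simp
  change ((G.localNli i ⊗ₖ (1 : Matrix (Fin Q) (Fin Q) ℝ)) *ᵥ
    (blockDiagMatrix M *ᵥ colStack x)) (0, r) = _
  rw [Matrix.mulVec, dotProduct, Fintype.sum_prod_type]
  refine Finset.sum_congr rfl fun k _ => ?_
  simp [hblock, Matrix.kroneckerMap_apply, Matrix.one_apply]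

end Observer

theorem corollary1 {n m q Q : ℕ} (G : CommGraph n m)
    (hreach : G.FollowersReachable) (hacyc : G.Acyclic)
    (S : Fin m → Matrix (Fin q) (Fin q) ℝ) (D : Fin m → Matrix (Fin Q) (Fin q) ℝ)
    (hS : ∀ k, MarginallyStable (S k))
    (βη βS βD : ℝ) (hβη : 0 < βη) (hβS : 0 < βS) (hβD : 0 < βD) :
    ∃ α : ℝ, 0 < α ∧
      ∀ (ω : ℝ → Fin m → Fin q → ℝ)
        (η : ℝ → G.Estimates (Fin q → ℝ))
        (Sh : ℝ → G.Estimates (Matrix (Fin q) (Fin q) ℝ))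
        (Dh : ℝ → G.Estimates (Matrix (Fin Q) (Fin q) ℝ)),
        IsLeaderTrajectory S ω →
        IsObserverTrajectory G S D βη βS βD ω η Sh Dh →
        ∀ i : Fin n, ∃ C : ℝ, ∀ t : ℝ, 0 ≤ t →
          ‖estimatedReference G (Dh t) (η t) i - virtualReference G D (ω t) i‖
            ≤ C * Real.exp (-α * t) := by
  -- A rate below the weights scaled by the smallest gain serves all three observers, whatever the
  -- trajectory.
  have hpos : 0 < min βη (min βS βD) := lt_min hβη (lt_min hβS hβD)
  obtain ⟨α, hα, hαβ⟩ := G.exists_rate_lt hpos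
  have hle : ∀ β, min βη (min βS βD) ≤ β →
      ∀ i, ∀ k ∈ G.influentialLeaders i, α < β * G.correctionWeight i k :=
    fun β hβ i k hk => (hαβ i k hk).trans_le
      (mul_le_mul_of_nonneg_right hβ (G.correctionWeight_pos hk).le)
  refine ⟨α, hα, fun ω η Sh Dh hω h i => ?_⟩
  have hout := h.isBigO_output_error hacyc hS hω hα (hle βη (min_le_left _ _))
    (hle βS ((min_le_right _ _).trans (min_le_left _ _)))
    (hle βD ((min_le_right _ _).trans (min_le_right _ _))) i
  have hcoord : ∀ r, (fun t => (estimatedReference G (Dh t) (η t) i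
      - virtualReference G D (ω t) i) r) =O[𝓟 (Ici 0)] fun t => Real.exp (-α * t) := by
    intro r
    have hr := IsBigO.fun_sum fun k (_ : k ∈ (Finset.univ : Finset (G.influentialLeaders i))) =>
      (isBigO_pi.1 (hout k) r).const_mul_left (G.localNli i 0 k)
    refine hr.congr_left fun t => ?_
    simp only [estimatedReference, virtualReference, PiLp.sub_apply, virtualOutput_apply,
      Pi.sub_apply, mul_sub, Finset.sum_sub_distrib]
  -- Coordinatewise decay controls the sup norm; this continuous linear equivalence carries it to
  -- the Euclidean norm.
  have hvec := ((PiLp.continuousLinearEquiv 2 ℝ fun _ : Fin Q => ℝ).symm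
    : (Fin Q → ℝ) →L[ℝ] EuclideanSpace ℝ (Fin Q)).isBigO_comp
      (fun t => WithLp.ofLp (estimatedReference G (Dh t) (η t) i
        - virtualReference G D (ω t) i)) (𝓟 (Ici 0))
  obtain ⟨C, hC⟩ := isBigO_principal.1 (hvec.trans (isBigO_pi.2 hcoord))
  refine ⟨C, fun t ht => ?_⟩
  have := hC t ht
  rwa [Real.norm_eq_abs, Real.abs_exp] at this
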